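/- Fix $n\ge 1$. An information structure for $n$ experts consists of a probability space $(\Omega,\mathbb P)$, signals $\sigma_1,\dots,\sigma_n$ (random variables on $\Omega$), and a real random variable $Y$ with $\mathbb E[Y^2]<\infty$. For $A,B\subseteq[n]$ put $Y_A:=\mathbb E[Y\mid \sigma_j,\ j\in A]$, $Y_i:=Y_{\{i\}}$, and $Y_{B\to A}:=\mathbb E[Y_B\mid \sigma_j,\ j\in A]$. The structure satisfies projective substitutes if for all $A,B\subseteq[n]$ and $i\in[n]$ $$\mathbb E\big[(Y_B-Y_{B\to A})^2\big]\ \ge\ \mathbb E\big[(Y_{B\cup\{i\}}-Y_{B\cup\{i\}\to A\cup\{i\}})^2\big].\qquad(*)$$ For an estimate $X$ of $Y$ let $v(X):=\mathbb E[(Y-\mathbb E Y)^2]-\mathbb E[(Y-X)^2]\in[-\infty,\infty)$; the approximation ratio of $X$ is $v(X)/v(Y_{[n]})$. A prior-free aggregation strategy outputs an estimate $X$ that is a measurable function of the forecasts $(Y_1,\dots,Y_n)$ or, if it is randomized, a random number whose conditional law given the state $\omega$ is $\kappa(Y_1(\omega),\dots,Y_n(\omega))$, for a Markov kernel $\kappa$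 from $\mathbb R^n$ to $\mathbb R$. For every $\mu\in\mathbb R$ let $\mathcal I_\mu$ be an information structure in which the signals $\sigma_1,\dots,\sigma_n$ are independent with law $N(\mu,1)$ and $Y=\sum_{i=1}^n\sigma_i$. Then: (i) For every $\mu$, $\mathcal I_\mu$ satisfies projective substitutes, and $(*)$ holds with equality whenever $i\notin B\setminus A$. (ii) There is no prior-free aggregation strategy, deterministic or randomized, whose approximation ratio is greater than $\frac2n-\frac1{n^2}$ on $\mathcal I_\mu$ for every $\mu\in\mathbb R$. (The strategy may depend on $n$ but not on $\mu$.) -/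

import Mathlib

open MeasureTheory ProbabilityTheory
open scoped ENNReal

/-- An information structure for `n` experts on a space `Ω` of states of the world: a probability
distribution `P` over the states, a signal `σ i : Ω → S i` for each expert `i`, and a
square-integrable real random variable `Y`, the quantity to be estimated. -/
structure InformationStructure (n : ℕ) (Ω : Type*) [MeasurableSpace Ω] where
  P : Measure Ω
  isProbabilityMeasure : IsProbabilityMeasure P
  S : Fin n → Type*
  measurableSpaceS : ∀ i, MeasurableSpace (S i)
  σ : ∀ i, Ω → S i
  measurable_σ : ∀ i, Measurable (σ i)
  Y : Ω → ℝ
  measurable_Y : Measurable Y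
  memLp_Y : MemLp Y 2 P

attribute [instance] InformationStructure.isProbabilityMeasure
attribute [instance] InformationStructure.measurableSpaceS

/-- The mean square `E[Z²]` of a real random variable, as an extended real (it may be `+∞`). -/
noncomputable def meanSquare {Ω : Type*} [MeasurableSpace Ω] (P : Measure Ω) (Z : Ω → ℝ) : EReal :=
  ((∫⁻ ω, ENNReal.ofReal (Z ω ^ 2) ∂P : ℝ≥0∞) : EReal)

/-- The quality `v(X) = E[(Y - E Y)²] - E[(Y - X)²]` of `X` as an estimate of `Y`. It is `-∞` for an
estimate `X` of a square-integrable `Y` that has infinite expected squared error. -/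
noncomputable def quality {Ω : Type*} [MeasurableSpace Ω] (P : Measure Ω) (Y X : Ω → ℝ) : EReal :=
  meanSquare P (fun ω => Y ω - ∫ ω', Y ω' ∂P) - meanSquare P (fun ω => Y ω - X ω)

namespace InformationStructure

variable {n : ℕ} {Ω : Type*} [MeasurableSpace Ω]

/-- The σ-algebra generated by the signals of the experts in `A`. -/
def info (I : InformationStructure n Ω) (A : Finset (Fin n)) : MeasurableSpace Ω :=
  ⨆ i ∈ A, (I.measurableSpaceS i).comap (I.σ i)

/-- The belief `Y_A = E[Y | σ_i : i ∈ A]` of the set `A` of experts. -/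
noncomputable def belief (I : InformationStructure n Ω) (A : Finset (Fin n)) : Ω → ℝ :=
  I.P[I.Y | I.info A]

/-- `A`'s prediction of `B`'s belief, `Y_{B → A} = E[Y_B | σ_i : i ∈ A]`. -/
noncomputable def prediction (I : InformationStructure n Ω) (B A : Finset (Fin n)) : Ω → ℝ :=
  I.P[I.belief B | I.info A]

/-- The expected squared error `E[(Y_B - Y_{B → A})²]` of `A`'s prediction of `B`'s belief. The
integrand is integrable, because `Y` is square-integrable. -/
noncomputable def predictionError (I : InformationStructure n Ω) (B A : Finset (Fin n)) : ℝ :=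
  ∫ ω, (I.belief B ω - I.prediction B A ω) ^ 2 ∂I.P

/-- Projective substitutes. -/
def ProjectiveSubstitutes (I : InformationStructure n Ω) : Prop :=
  ∀ (A B : Finset (Fin n)) (i : Fin n),
    I.predictionError B A ≥ I.predictionError (B ∪ {i}) (A ∪ {i})

/-- The tuple `(Y_1, …, Y_n)` of the experts' individual forecasts `Y_i = Y_{{i}}`. -/
noncomputable def forecasts (I : InformationStructure n Ω) (ω : Ω) : Fin n → ℝ :=
  fun i => I.belief {i} ω

theorem info_le (I : InformationStructure n Ω) (A : Finset (Fin n)) : I.info A ≤ ‹_› :=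
  iSup₂_le fun i _ => (I.measurable_σ i).comap_le

theorem measurable_forecasts (I : InformationStructure n Ω) : Measurable I.forecasts :=
  measurable_pi_lambda _ fun i =>
    (stronglyMeasurable_condExp.mono (I.info_le {i})).measurable

/-- The approximation ratio `v(Z) / v(Y_{[n]})` of a random variable `Z`. -/
noncomputable def approxRatio (I : InformationStructure n Ω) (Z : Ω → ℝ) : EReal :=
  quality I.P I.Y Z / quality I.P I.Y (I.belief Finset.univ)

/-- The approximation ratio of a randomized prior-free aggregation strategy `κ`, which on reports
`y` outputs a random number with law `κ y`. The state space is enlarged to `Ω × ℝ`, where the second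
coordinate is the output: given the state `ω` it has law `κ (Y_1(ω), …, Y_n(ω))`. -/
noncomputable def randomizedApproxRatio (I : InformationStructure n Ω)
    (κ : Kernel (Fin n → ℝ) ℝ) : EReal :=
  quality (I.P ⊗ₘ κ.comap I.forecasts I.measurable_forecasts) (fun p => I.Y p.1) (fun p => p.2)
    / quality I.P I.Y (I.belief Finset.univ)

end InformationStructure

/-- The information structure in which each expert `i` receives the real signal `σ i`, the signals
are independent with law `N(μ, 1)`, and `Y = ∑ i, σ i`. -/
noncomputable def gaussianSumStructure {n : ℕ} {Ω : Type*} [MeasurableSpace Ω] (μ : ℝ)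
    (P : Measure Ω) [hP : IsProbabilityMeasure P] (σ : Fin n → Ω → ℝ)
    (measurable_σ : ∀ i, Measurable (σ i)) (_indep : iIndepFun σ P)
    (law : ∀ i, P.map (σ i) = gaussianReal μ 1) : InformationStructure n Ω where
  P := P
  isProbabilityMeasure := hP
  S := fun _ => ℝ
  measurableSpaceS := fun _ => inferInstance
  σ := σ
  measurable_σ := measurable_σ
  Y := fun ω => ∑ i, σ i ω
  measurable_Y := Finset.measurable_fun_sum _ fun i _ => measurable_σ i
  memLp_Y := memLp_finsetSum _ fun i _ => by
    have h : MemLp id 2 (P.map (σ i)) := by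
      rw [law i]; exact memLp_id_gaussianReal 2
    exact h.comp_of_map (measurable_σ i).aemeasurable

/-!
In the Gaussian sum structure, the belief of `A` is `∑ j ∈ A, σ j + (n - #A) μ`, so the error of
`A`'s prediction of `B`'s belief is the noise in the signals of `B \ A`, with mean square
`#(B \ A)` (`predictionError_gaussianSumStructure`). Adding `i` to both sets removes `i` from `B \ A`,
which gives the first two claims.

For the bounds, the forecasts `Y_i = σ_i + (n - 1) μ` are independent with law `N(m, 1)`, where
`m = n μ`, and `Y = ∑ i, Y_i - (n - 1) m`. Hence, for `n ≥ 2`, a deterministic strategy `X` amounts to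
an estimator `D = (∑ i, Y_i - X) / (n - 1)` of `m` from `n` observations with law `N(m, 1)`: the
error of `X` is `(n - 1) (D - m)`, up to sign, and `X` has a ratio greater than `2 / n - 1 / n²`
exactly when `E[(D - m)²] < 1 / n`. For no `D` does this hold for every `m`, because the sample
mean is admissible (`exists_le_lintegral_sq_gaussianSample`). A randomized strategy is no better
than its conditional mean given the forecasts, by Jensen's inequality. For `n = 1` the bound is
`1`, and no estimate has a ratio greater than that.

The proof of admissibility is a discrete form of the argument of Hodges and Lehmann. It uses the
Chapman–Robbins inequality in place of the Cramér–Rao inequality, so that the bias `b` of `D` need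
not be differentiated. If the mean squared error is less than `1 / n` everywhere, this inequality
for a translation by `h > 0` implies `b (m + h) ≤ b m - (n / 2) (b m)² h + (n / 2) h³` for small
`h`. Summed over fine subdivisions, it shows that `b` is antitone and decreases at a positive rate
where it is bounded away from `0`; being bounded, `b` vanishes. For an unbiased estimator the
inequality gives, as `h → 0`, a mean squared error of at least `1 / n`.
-/

/-! ### The Chapman–Robbins inequality -/

theorem covariance_sq_le_variance_mul_variance {Ω : Type*} [MeasurableSpace Ω] {P : Measure Ω}
    [IsFiniteMeasure P] {X Y : Ω → ℝ} (hX : MemLp X 2 P) (hY : MemLp Y 2 P) :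
    cov[X, Y; P] ^ 2 ≤ Var[X; P] * Var[Y; P] := by
  have key : ∀ t : ℝ, 0 ≤ Var[Y; P] * (t * t) + 2 * cov[X, Y; P] * t + Var[X; P] := fun t => by
    have h := variance_nonneg (fun ω => X ω + t * Y ω) P
    rw [variance_fun_add hX (hY.const_mul t), covariance_const_mul_right, variance_const_mul] at h
    linarith
  have h := discrim_le_zero key
  unfold discrim at h
  linarith

/-- The Chapman–Robbins inequality, for the change of measure from `P` to the law with density `L`:
the left-hand side is the squared covariance of `T` and `L` under `P`. -/
theorem sq_integral_withDensity_sub_le {Ω : Type*} [MeasurableSpace Ω] {P : Measure Ω}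
    [IsProbabilityMeasure P] {L T : Ω → ℝ} (hLm : Measurable L) (hL0 : ∀ ω, 0 ≤ L ω)
    (hL : MemLp L 2 P) (hL1 : ∫ ω, L ω ∂P = 1) (hT : MemLp T 2 P) :
    (∫ ω, T ω ∂(P.withDensity fun ω => ENNReal.ofReal (L ω)) - ∫ ω, T ω ∂P) ^ 2
      ≤ Var[T; P] * (∫ ω, L ω ^ 2 ∂P - 1) := by
  have h := covariance_sq_le_variance_mul_variance hT hL
  rw [covariance_eq_sub hT hL, variance_eq_sub hL, hL1] at h
  rw [integral_withDensity_eq_integral_toReal_smul (by fun_prop) (by simp)]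
  simp only [ENNReal.toReal_ofReal (hL0 _), smul_eq_mul]
  simpa [mul_comm] using h

/-! ### Translations of a product of Gaussian laws -/

/-- The law of `n` independent observations with law `N(m, 1)`. -/
noncomputable def gaussianSample (n : ℕ) (m : ℝ) : Measure (Fin n → ℝ) :=
  Measure.pi fun _ => gaussianReal m 1

instance (n : ℕ) (m : ℝ) : IsProbabilityMeasure (gaussianSample n m) := by
  unfold gaussianSample; infer_instance

/-- The likelihood ratio of `gaussianSample n (m + h)` to `gaussianSample n m`. -/
noncomputable def likelihoodRatio (n : ℕ) (m h : ℝ) (y : Fin n → ℝ) : ℝ :=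
  ∏ i, Real.exp (h * (y i - m) - h ^ 2 / 2)

theorem gaussianReal_add_eq_withDensity (m h : ℝ) :
    gaussianReal (m + h) 1 = (gaussianReal m 1).withDensity
      fun x => ENNReal.ofReal (Real.exp (h * (x - m) - h ^ 2 / 2)) := by
  rw [gaussianReal_of_var_ne_zero _ one_ne_zero, gaussianReal_of_var_ne_zero _ one_ne_zero,
    ← withDensity_mul _ (by fun_prop) (by fun_prop)]
  congr 1
  ext x
  simp only [gaussianPDF, gaussianPDFReal, Pi.mul_apply]
  rw [← ENNReal.ofReal_mul (by positivity), mul_assoc _ (Real.exp _), ← Real.exp_add]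
  congr 3
  simp only [NNReal.coe_one]
  ring

theorem measurable_likelihoodRatio (n : ℕ) (m h : ℝ) : Measurable (likelihoodRatio n m h) := by
  unfold likelihoodRatio; fun_prop

theorem likelihoodRatio_nonneg (n : ℕ) (m h : ℝ) (y : Fin n → ℝ) : 0 ≤ likelihoodRatio n m h y :=
  Finset.prod_nonneg fun _ _ => (Real.exp_pos _).le

theorem gaussianSample_add_eq_withDensity (n : ℕ) (m h : ℝ) :
    gaussianSample n (m + h) = (gaussianSample n m).withDensity
      fun y => ENNReal.ofReal (likelihoodRatio n m h y) := by
  refine Measure.pi_eq fun s hs => ?_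
  set f : ℝ → ℝ≥0∞ := fun x => ENNReal.ofReal (Real.exp (h * (x - m) - h ^ 2 / 2)) with hf
  have hfm : Measurable f := by fun_prop
  have hgm : ∀ i, Measurable ((s i).indicator f) := fun i => hfm.indicator (hs i)
  have hind : iIndepFun (fun i (y : Fin n → ℝ) => (s i).indicator f (y i)) (gaussianSample n m) :=
    iIndepFun_pi fun i => (hgm i).aemeasurable
  have hprod : ∀ y : Fin n → ℝ, (Set.univ.pi s).indicator
      (fun y => ENNReal.ofReal (likelihoodRatio n m h y)) y = ∏ i, (s i).indicator f (y i) := by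
    intro y
    by_cases hy : y ∈ Set.univ.pi s
    · rw [Set.indicator_of_mem hy, likelihoodRatio,
        ENNReal.ofReal_prod_of_nonneg fun _ _ => (Real.exp_pos _).le]
      exact Finset.prod_congr rfl fun i _ => (Set.indicator_of_mem (hy i trivial) f).symm
    · rw [Set.indicator_of_notMem hy]
      obtain ⟨i, hi⟩ : ∃ i, y i ∉ s i := by simpa [Set.mem_pi] using hy
      exact (Finset.prod_eq_zero (Finset.mem_univ i) (Set.indicator_of_notMem hi f)).symm
  rw [withDensity_apply _ (MeasurableSet.univ_pi hs), ← lintegral_indicator (.univ_pi hs)]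
  simp_rw [hprod]
  rw [lintegral_prod_eq_prod_lintegral_of_indepFun _ _ hind
    fun i => (hgm i).comp (measurable_pi_apply i)]
  refine Finset.prod_congr rfl fun i _ => ?_
  rw [gaussianReal_add_eq_withDensity, withDensity_apply _ (hs i), ← lintegral_indicator (hs i)]
  exact (measurePreserving_eval (fun _ : Fin n => gaussianReal m 1) i).lintegral_comp (hgm i)

theorem lintegral_likelihoodRatio (n : ℕ) (m h : ℝ) :
    ∫⁻ y, ENNReal.ofReal (likelihoodRatio n m h y) ∂gaussianSample n m = 1 := by
  have h1 : gaussianSample n (m + h) Set.univ = 1 := measure_univ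
  rwa [gaussianSample_add_eq_withDensity, withDensity_apply _ .univ, setLIntegral_univ] at h1

theorem integrable_likelihoodRatio (n : ℕ) (m h : ℝ) :
    Integrable (likelihoodRatio n m h) (gaussianSample n m) := by
  refine ⟨(measurable_likelihoodRatio n m h).aestronglyMeasurable, ?_⟩
  rw [hasFiniteIntegral_iff_ofReal (.of_forall (likelihoodRatio_nonneg n m h)),
    lintegral_likelihoodRatio]
  exact ENNReal.one_lt_top

theorem integral_likelihoodRatio (n : ℕ) (m h : ℝ) :
    ∫ y, likelihoodRatio n m h y ∂gaussianSample n m = 1 := by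
  rw [integral_eq_lintegral_of_nonneg_ae (.of_forall (likelihoodRatio_nonneg n m h))
    (measurable_likelihoodRatio n m h).aestronglyMeasurable, lintegral_likelihoodRatio]
  rfl

theorem likelihoodRatio_sq (n : ℕ) (m h : ℝ) (y : Fin n → ℝ) :
    likelihoodRatio n m h y ^ 2 = Real.exp (n * h ^ 2) * likelihoodRatio n m (2 * h) y := by
  have hc : Real.exp (n * h ^ 2) = ∏ _i : Fin n, Real.exp (h ^ 2) := by
    simp [← Real.exp_nat_mul]
  rw [likelihoodRatio, likelihoodRatio, hc, ← Finset.prod_pow, ← Finset.prod_mul_distrib]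
  refine Finset.prod_congr rfl fun i _ => ?_
  rw [← Real.exp_nat_mul, ← Real.exp_add]
  congr 1
  push_cast
  ring

theorem memLp_likelihoodRatio (n : ℕ) (m h : ℝ) :
    MemLp (likelihoodRatio n m h) 2 (gaussianSample n m) := by
  rw [memLp_two_iff_integrable_sq (measurable_likelihoodRatio n m h).aestronglyMeasurable]
  simp_rw [likelihoodRatio_sq]
  exact (integrable_likelihoodRatio n m (2 * h)).const_mul _

theorem integral_likelihoodRatio_sq (n : ℕ) (m h : ℝ) :
    ∫ y, likelihoodRatio n m h y ^ 2 ∂gaussianSample n m = Real.exp (n * h ^ 2) := by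
  simp_rw [likelihoodRatio_sq]
  rw [integral_const_mul, integral_likelihoodRatio, mul_one]

/-! ### Admissibility of the sample mean -/

/-- Summing the one-step estimate over a subdivision of `[m, m + t]` into ever smaller steps makes
its cubic error term disappear. -/
theorem add_le_sub_of_step {b : ℝ → ℝ} {k ε : ℝ} (hε : 0 < ε)
    (step : ∀ m h, 0 < h → h ≤ ε → b (m + h) ≤ b m - k * b m ^ 2 * h + k * h ^ 3)
    (hk : 0 ≤ k) {c m t : ℝ} (ht : 0 < t)
    (hc : ∀ s, m ≤ s → s ≤ m + t → c ≤ b s ^ 2) :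
    b (m + t) ≤ b m - k * c * t := by
  have main : ∀ᶠ N : ℕ in Filter.atTop,
      b (m + t) ≤ b m - k * c * t + k * t ^ 3 * ((N : ℝ)⁻¹ * (N : ℝ)⁻¹) := by
    filter_upwards [Filter.eventually_ge_atTop (⌈t / ε⌉₊ + 1)] with N hN
    have hN0 : (0 : ℝ) < N := by exact_mod_cast (by omega : 0 < N)
    have hNε : t / N ≤ ε := by
      rw [div_le_iff₀ hN0, ← div_le_iff₀' hε]
      exact (Nat.le_ceil _).trans (by exact_mod_cast (by omega : ⌈t / ε⌉₊ ≤ N))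
    have hh : 0 < t / N := by positivity
    have ind : ∀ j : ℕ, j ≤ N → b (m + j * (t / N)) ≤
        b m + j * (- (k * c * (t / N)) + k * (t / N) ^ 3) := by
      intro j
      induction j with
      | zero => simp
      | succ j ih =>
        intro hj
        have hjN : (j : ℝ) * (t / N) ≤ t := by
          calc (j : ℝ) * (t / N) ≤ N * (t / N) := by
                gcongr; exact_mod_cast (by omega : j ≤ N)
            _ = t := by field_simp
        have h1 := step (m + j * (t / N)) (t / N) hh hNε
        have h2 := hc (m + j * (t / N)) (by linarith [show 0 ≤ (j : ℝ) * (t / N) by positivity])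
          (by linarith)
        have h3 : k * c * (t / N) ≤ k * b (m + j * (t / N)) ^ 2 * (t / N) := by gcongr
        have h4 := ih (by omega)
        push_cast
        rw [show m + ((j : ℝ) + 1) * (t / N) = m + j * (t / N) + t / N by ring]
        linarith
    have h := ind N le_rfl
    rw [show (N : ℝ) * (t / N) = t by field_simp] at h
    refine h.trans (le_of_eq ?_)
    field_simp
    ring
  have lim : Filter.Tendsto
      (fun N : ℕ => b m - k * c * t + k * t ^ 3 * ((N : ℝ)⁻¹ * (N : ℝ)⁻¹))
      Filter.atTop (nhds (b m - k * c * t + k * t ^ 3 * (0 * 0))) :=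
    ((tendsto_inv_atTop_nhds_zero_nat.mul tendsto_inv_atTop_nhds_zero_nat).const_mul _).const_add _
  simpa using ge_of_tendsto lim main

/-- A bounded solution of the discretized differential inequality `b' ≤ -k b²` vanishes: it is
antitone, and where it is bounded away from `0` it decreases at a positive rate. -/
theorem eq_zero_of_step {b : ℝ → ℝ} {k ε C : ℝ} (hε : 0 < ε) (hk : 0 < k) (hC : ∀ m, |b m| ≤ C)
    (step : ∀ m h, 0 < h → h ≤ ε → b (m + h) ≤ b m - k * b m ^ 2 * h + k * h ^ 3) (m : ℝ) :
    b m = 0 := by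
  have anti : ∀ x y, x ≤ y → b y ≤ b x := by
    intro x y hxy
    rcases hxy.eq_or_lt with rfl | hlt
    · exact le_rfl
    · have h := add_le_sub_of_step hε step hk.le (c := 0) (m := x) (sub_pos.2 hlt)
        fun s _ _ => sq_nonneg _
      simpa using h
  by_contra h0
  have hpos : 0 < k * b m ^ 2 := by positivity
  have hC0 : 0 ≤ C := (abs_nonneg _).trans (hC m)
  -- a time in which a decrease at rate `k * b m ^ 2` exceeds the range `[-C, C]`
  set t := (2 * C + 1) / (k * b m ^ 2) with ht
  have ht0 : 0 < t := by positivity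
  have hkt : k * b m ^ 2 * t = 2 * C + 1 := by rw [ht]; field_simp
  rcases lt_or_gt_of_ne h0 with hneg | hpos'
  · have h := add_le_sub_of_step hε step hk.le (c := b m ^ 2) (m := m) ht0 fun s hs _ => by
      have := anti m s hs; nlinarith
    linarith [(abs_le.1 (hC (m + t))).1, (abs_le.1 (hC m)).2]
  · have h := add_le_sub_of_step hε step hk.le (c := b m ^ 2) (m := m - t) ht0 fun s _ hs => by
      have := anti s m (by linarith); nlinarith
    rw [sub_add_cancel] at h
    linarith [(abs_le.1 (hC m)).1, (abs_le.1 (hC (m - t))).2]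

/-- The Chapman–Robbins inequalities of an estimator with bias `b` and mean squared error `R`
cannot all hold if `R` is everywhere less than `1 / n`. -/
theorem not_chapmanRobbins {n : ℝ} (hn : 0 < n) {b R : ℝ → ℝ} (hR : ∀ m, R m < 1 / n)
    (h0 : ∀ m, b m ^ 2 ≤ R m)
    (hCR : ∀ m h, (h + b (m + h) - b m) ^ 2 ≤ (R m - b m ^ 2) * (Real.exp (n * h ^ 2) - 1)) :
    False := by
  have hexp : ∀ x : ℝ, 0 ≤ x → x ≤ 1 → Real.exp x - 1 ≤ x * (1 + x) := fun x hx0 hx1 => by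
    have := (abs_le.1 (Real.abs_exp_sub_one_sub_id_le (x := x) (by rwa [abs_of_nonneg hx0]))).2
    linarith
  have hsmall : ∀ h : ℝ, 0 < h → h ≤ 1 / (n + 1) → n * h ^ 2 ≤ 1 := fun h hh hle => by
    rw [le_div_iff₀ (by positivity)] at hle
    nlinarith [mul_pos hn hh]
  have hCR' : ∀ m h, 0 < h → h ≤ 1 / (n + 1) →
      (h + b (m + h) - b m) ^ 2 ≤ (R m - b m ^ 2) * (n * h ^ 2 * (1 + n * h ^ 2)) :=
    fun m h hh hle => (hCR m h).trans <|
      mul_le_mul_of_nonneg_left (hexp _ (by positivity) (hsmall h hh hle)) (sub_nonneg.2 (h0 m))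
  have step : ∀ m h, 0 < h → h ≤ 1 / (n + 1) →
      b (m + h) ≤ b m - n / 2 * b m ^ 2 * h + n / 2 * h ^ 3 := by
    intro m h hh hle
    have h1 := hCR' m h hh hle
    have h2 : n * R m ≤ 1 := by have := hR m; rw [lt_div_iff₀ hn] at this; linarith
    have hq : 0 ≤ n * h ^ 2 := by positivity
    have hb : 0 ≤ n * b m ^ 2 := by positivity
    have hbn : n * b m ^ 2 ≤ 1 := (mul_le_mul_of_nonneg_left (h0 m) hn.le).trans h2
    set u := n * h ^ 2 - n * b m ^ 2 with hu
    -- the right-hand side is `h ^ 2 * (1 + u)` at most, and `√(1 + u) ≤ 1 + u / 2`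
    have h3 : (h + b (m + h) - b m) ^ 2 ≤ (h * (1 + u / 2)) ^ 2 := by
      refine h1.trans ?_
      calc (R m - b m ^ 2) * (n * h ^ 2 * (1 + n * h ^ 2))
          = (n * R m - n * b m ^ 2) * (1 + n * h ^ 2) * h ^ 2 := by ring
        _ ≤ (1 - n * b m ^ 2) * (1 + n * h ^ 2) * h ^ 2 := by gcongr
        _ ≤ (1 + u / 2) ^ 2 * h ^ 2 := by
            gcongr
            nlinarith [mul_nonneg hb hq, sq_nonneg u]
        _ = _ := by ring
    have h4 := abs_le_of_sq_le_sq h3 (mul_nonneg hh.le (by linarith))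
    have h5 := (le_abs_self _).trans h4
    rw [hu] at h5
    linarith
  have hb : ∀ m, b m = 0 := by
    refine eq_zero_of_step (C := 1 + 1 / n) (by positivity) (by positivity) (fun m => ?_) step
    have h1 := (h0 m).trans (hR m).le
    rw [← sq_abs] at h1
    nlinarith [sq_nonneg (|b m| - 1), abs_nonneg (b m), one_div_pos.2 hn]
  -- for an unbiased estimator, the inequality at `m = 0` gives `1 ≤ n * R 0` as `h → 0`
  have key : ∀ᶠ h in nhdsWithin (0 : ℝ) (Set.Ioi 0), 1 ≤ R 0 * (n * (1 + n * h ^ 2)) := by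
    filter_upwards [Ioc_mem_nhdsGT (show (0 : ℝ) < 1 / (n + 1) by positivity)] with h hh
    have h1 := hCR' 0 h hh.1 hh.2
    simp only [hb] at h1
    have h2 : 0 < h ^ 2 := pow_pos hh.1 2
    nlinarith
  have lim : Filter.Tendsto (fun h : ℝ => R 0 * (n * (1 + n * h ^ 2)))
      (nhdsWithin 0 (Set.Ioi 0)) (nhds (R 0 * (n * (1 + n * 0 ^ 2)))) :=
    (Continuous.tendsto (by fun_prop) 0).mono_left nhdsWithin_le_nhds
  have h1 := ge_of_tendsto lim key
  have h2 := hR 0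
  rw [lt_div_iff₀ hn] at h2
  linarith

/-- No estimator of the mean `m` from `n` independent observations with law `N(m, 1)` has a mean
squared error less than that of the sample mean, `1 / n`, for every `m`. -/
theorem exists_le_lintegral_sq_gaussianSample {n : ℕ} (hn : 0 < n) {D : (Fin n → ℝ) → ℝ}
    (hD : Measurable D) :
    ∃ m, ENNReal.ofReal (1 / n) ≤ ∫⁻ y, ENNReal.ofReal ((D y - m) ^ 2) ∂gaussianSample n m := by
  by_contra! hlt
  have hint : ∀ m, Integrable (fun y => (D y - m) ^ 2) (gaussianSample n m) := fun m => by
    refine ⟨by fun_prop, ?_⟩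
    rw [hasFiniteIntegral_iff_ofReal (.of_forall fun _ => sq_nonneg _)]
    exact (hlt m).trans ENNReal.ofReal_lt_top
  have hLp : ∀ m, MemLp (fun y => D y - m) 2 (gaussianSample n m) := fun m =>
    (memLp_two_iff_integrable_sq (by fun_prop)).2 (hint m)
  have hDLp : ∀ m, MemLp D 2 (gaussianSample n m) := fun m => by
    convert (hLp m).add (memLp_const m) using 1
    ext y
    simp
  have hvar : ∀ m, Var[D; gaussianSample n m] =
      ∫ y, (D y - m) ^ 2 ∂gaussianSample n m - (∫ y, D y ∂gaussianSample n m - m) ^ 2 := by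
    intro m
    rw [← variance_sub_const hD.aestronglyMeasurable m, variance_eq_sub (hLp m),
      integral_sub ((hDLp m).integrable (by norm_num)) (integrable_const m)]
    simp
  refine not_chapmanRobbins (n := n) (by exact_mod_cast hn)
    (b := fun m => ∫ y, D y ∂gaussianSample n m - m)
    (R := fun m => ∫ y, (D y - m) ^ 2 ∂gaussianSample n m) (fun m => ?_) (fun m => ?_)
    (fun m h => ?_)
  · have h := hlt m
    rw [← ofReal_integral_eq_lintegral_ofReal (hint m) (.of_forall fun _ => sq_nonneg _)] at h
    exact (ENNReal.ofReal_lt_ofReal_iff_of_nonneg (integral_nonneg fun _ => sq_nonneg _)).1 h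
  · have := hvar m ▸ variance_nonneg D (gaussianSample n m)
    linarith
  · have h1 := sq_integral_withDensity_sub_le (measurable_likelihoodRatio n m h)
      (likelihoodRatio_nonneg n m h) (memLp_likelihoodRatio n m h)
      (integral_likelihoodRatio n m h) (hDLp m)
    rw [← gaussianSample_add_eq_withDensity, integral_likelihoodRatio_sq, hvar] at h1
    convert h1 using 2
    ring

/-! ### Beliefs and prediction errors in the Gaussian sum structure -/

theorem memLp_of_map_gaussianReal {Ω : Type*} [MeasurableSpace Ω] {μ : ℝ} {P : Measure Ω}
    {X : Ω → ℝ} (hX : Measurable X) (hlaw : P.map X = gaussianReal μ 1) : MemLp X 2 P := by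
  have h : MemLp id 2 (P.map X) := hlaw ▸ memLp_id_gaussianReal 2
  exact h.comp_of_map hX.aemeasurable

theorem integral_of_map_gaussianReal {Ω : Type*} [MeasurableSpace Ω] {μ : ℝ} {P : Measure Ω}
    {X : Ω → ℝ} (hX : Measurable X) (hlaw : P.map X = gaussianReal μ 1) : ∫ ω, X ω ∂P = μ := by
  rw [← integral_id_gaussianReal (μ := μ) (v := 1), ← hlaw,
    integral_map hX.aemeasurable (by fun_prop)]

theorem variance_of_map_gaussianReal {Ω : Type*} [MeasurableSpace Ω] {μ : ℝ} {P : Measure Ω}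
    {X : Ω → ℝ} (hX : Measurable X) (hlaw : P.map X = gaussianReal μ 1) : Var[X; P] = 1 := by
  have h := variance_map (X := id) (Y := X) (μ := P) (by fun_prop) hX.aemeasurable
  rw [hlaw, variance_id_gaussianReal] at h
  simpa using h.symm

section GaussianSum

variable {n : ℕ} {Ω : Type*} [MeasurableSpace Ω] {μ : ℝ} {P : Measure Ω} [IsProbabilityMeasure P]
  {σ : Fin n → Ω → ℝ} {measurable_σ : ∀ i, Measurable (σ i)} {indep : iIndepFun σ P}
  {law : ∀ i, P.map (σ i) = gaussianReal μ 1}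

theorem integral_sum_sub_sq (measurable_σ : ∀ i, Measurable (σ i)) (indep : iIndepFun σ P)
    (law : ∀ i, P.map (σ i) = gaussianReal μ 1) (s : Finset (Fin n)) :
    ∫ ω, (∑ j ∈ s, (σ j ω - μ)) ^ 2 ∂P = s.card := by
  have hLp : ∀ i, MemLp (σ i) 2 P := fun i => memLp_of_map_gaussianReal (measurable_σ i) (law i)
  have h := IndepFun.variance_sum (s := s) (fun i _ => hLp i)
    fun i _ j _ hij => indep.indepFun hij
  rw [Finset.sum_congr rfl fun i _ => variance_of_map_gaussianReal (measurable_σ i) (law i),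
    Finset.sum_const, nsmul_one,
    variance_eq_integral (Finset.aemeasurable_sum _ fun i _ => (measurable_σ i).aemeasurable)] at h
  rw [← h]
  have hE : ∫ ω, (∑ i ∈ s, σ i) ω ∂P = ∑ _i ∈ s, μ := by
    simp only [Finset.sum_apply]
    rw [integral_finsetSum _ fun i _ => (hLp i).integrable (by norm_num)]
    exact Finset.sum_congr rfl fun i _ => integral_of_map_gaussianReal (measurable_σ i) (law i)
  simp only [hE]
  simp [Finset.sum_sub_distrib]

local notation "𝓘" => gaussianSumStructure μ P σ measurable_σ indep law

theorem condExp_signal (A : Finset (Fin n)) (j : Fin n) :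
    P[σ j | (𝓘).info A] =ᵐ[P] fun ω => if j ∈ A then σ j ω else μ := by
  have hle := (𝓘).info_le A
  by_cases hj : j ∈ A
  · have hm : Measurable[(𝓘).info A] (σ j) :=
      (comap_measurable (σ j)).mono
        (le_iSup₂_of_le (f := fun i (_ : i ∈ A) =>
          MeasurableSpace.comap (σ i) (inferInstance : MeasurableSpace ℝ)) j hj le_rfl) le_rfl
    rw [condExp_of_stronglyMeasurable hle hm.stronglyMeasurable
      ((memLp_of_map_gaussianReal (measurable_σ j) (law j)).integrable (by norm_num))]
    simp [hj]
  · have hind := indep_iSup_of_disjoint (fun i => (measurable_σ i).comap_le)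
      ((iIndepFun_iff_iIndep _ _ _).1 indep) (S := {j}) (T := A) (by simpa using hj)
    simp only [Set.mem_singleton_iff, iSup_iSup_eq_left, Finset.mem_coe] at hind
    have h := condExp_indep_eq (measurable_σ j).comap_le hle
      (comap_measurable (σ j)).stronglyMeasurable hind
    rw [integral_of_map_gaussianReal (measurable_σ j) (law j)] at h
    simpa [hj] using h

theorem condExp_sum_signal (A B : Finset (Fin n)) :
    P[fun ω => ∑ j, if j ∈ B then σ j ω else μ | (𝓘).info A] =ᵐ[P]
      fun ω => ∑ j, if j ∈ B ∩ A then σ j ω else μ := by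
  have hle := (𝓘).info_le A
  have hint : ∀ j, Integrable (fun ω => if j ∈ B then σ j ω else μ) P := fun j => by
    by_cases hj : j ∈ B
    · simpa [hj] using
        (memLp_of_map_gaussianReal (measurable_σ j) (law j)).integrable (by norm_num)
    · simp [hj]
  have hterm : ∀ j, P[fun ω => if j ∈ B then σ j ω else μ | (𝓘).info A]
      =ᵐ[P] fun ω => if j ∈ B ∩ A then σ j ω else μ := fun j => by
    by_cases hj : j ∈ B
    · simpa [hj] using condExp_signal (indep := indep) (measurable_σ := measurable_σ)
        (law := law) A j
    · simp [hj, condExp_const hle]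
  have h := condExp_finsetSum (s := Finset.univ) (fun j _ => hint j)
    ((𝓘).info A)
  have heq : (∑ j, fun ω => if j ∈ B then σ j ω else μ) =
      fun ω => ∑ j, if j ∈ B then σ j ω else μ := by
    ext ω; simp only [Finset.sum_apply]
  rw [heq] at h
  filter_upwards [h, ae_all_iff.2 hterm] with ω h1 h2
  rw [h1, Finset.sum_apply]
  exact Finset.sum_congr rfl fun j _ => h2 j

theorem belief_gaussianSumStructure (A : Finset (Fin n)) :
    (𝓘).belief A =ᵐ[P] fun ω => ∑ j, if j ∈ A then σ j ω else μ := by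
  have h := condExp_sum_signal (indep := indep) (measurable_σ := measurable_σ) (law := law)
    A Finset.univ
  simp only [Finset.mem_univ, if_true, Finset.univ_inter] at h
  exact h

theorem prediction_gaussianSumStructure (A B : Finset (Fin n)) :
    (𝓘).prediction B A =ᵐ[P]
      fun ω => ∑ j, if j ∈ B ∩ A then σ j ω else μ :=
  (condExp_congr_ae (belief_gaussianSumStructure B)).trans (condExp_sum_signal A B)

/-- What `A` cannot predict of the belief of `B` is the noise in the signals of `B \ A`. -/
theorem predictionError_gaussianSumStructure (A B : Finset (Fin n)) :
    (𝓘).predictionError B A = (B \ A).card := by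
  rw [← integral_sum_sub_sq measurable_σ indep law (B \ A)]
  refine integral_congr_ae ?_
  filter_upwards [belief_gaussianSumStructure (indep := indep) (measurable_σ := measurable_σ)
      (law := law) B, prediction_gaussianSumStructure (indep := indep)
      (measurable_σ := measurable_σ) (law := law) A B] with ω h1 h2
  rw [h1, h2, ← Finset.sum_sub_distrib]
  congr 1
  refine (Finset.sum_subset_zero_on_sdiff (Finset.subset_univ (B \ A)) (fun j hj => ?_)
    fun j hj => ?_).symm
  · by_cases hB : j ∈ B <;> by_cases hA : j ∈ A <;> simp_all
  · obtain ⟨hB, hA⟩ := Finset.mem_sdiff.1 hj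
    simp [hB, hA]

/-! ### The quality of an aggregation strategy -/

theorem forecasts_gaussianSumStructure :
    (𝓘).forecasts =ᵐ[P] fun ω i => σ i ω + (n - 1) * μ := by
  filter_upwards [ae_all_iff.2 fun i => belief_gaussianSumStructure (indep := indep)
    (measurable_σ := measurable_σ) (law := law) {i}] with ω h
  ext i
  have hcard : ((Finset.univ.erase i).card : ℝ) = n - 1 := by
    rw [Finset.card_erase_of_mem (Finset.mem_univ i), Finset.card_univ, Fintype.card_fin,
      Nat.cast_sub i.pos, Nat.cast_one]
  rw [InformationStructure.forecasts, h i, ← Finset.add_sum_erase _ _ (Finset.mem_univ i)]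
  rw [Finset.sum_congr rfl fun j hj => if_neg (by simpa using Finset.ne_of_mem_erase hj)]
  rw [Finset.sum_const, nsmul_eq_mul, hcard, if_pos (Finset.mem_singleton_self i)]

theorem map_forecasts_gaussianSumStructure :
    P.map (𝓘).forecasts = gaussianSample n (n * μ) := by
  rw [Measure.map_congr forecasts_gaussianSumStructure]
  have h := (iIndepFun_iff_map_fun_eq_pi_map (f := fun i ω => σ i ω + (n - 1) * μ)
    (fun i => ((measurable_σ i).add_const _).aemeasurable)).1
    (indep.comp (fun _ x => x + (n - 1) * μ) fun _ => measurable_id.add_const _)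
  rw [h, gaussianSample]
  congr 1
  ext1 i
  have hmap : P.map (fun ω => σ i ω + (n - 1) * μ) =
      (P.map (σ i)).map fun x => x + (n - 1) * μ :=
    (Measure.map_map (measurable_id.add_const _) (measurable_σ i)).symm
  rw [hmap, law i, gaussianReal_map_add_const]
  congr 1
  ring

theorem meanSquare_Y_sub_integral :
    meanSquare P (fun ω => (𝓘).Y ω - ∫ ω', (𝓘).Y ω' ∂P) = (n : ℝ) := by
  have hLp : ∀ i, MemLp (σ i) 2 P := fun i => memLp_of_map_gaussianReal (measurable_σ i) (law i)
  have hE : ∫ ω', (𝓘).Y ω' ∂P = ∑ _j : Fin n, μ := by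
    change ∫ ω', ∑ i, σ i ω' ∂P = _
    rw [integral_finsetSum _ fun i _ => (hLp i).integrable (by norm_num)]
    exact Finset.sum_congr rfl fun i _ => integral_of_map_gaussianReal (measurable_σ i) (law i)
  have hZ : (fun ω => (𝓘).Y ω - ∫ ω', (𝓘).Y ω' ∂P) = fun ω => ∑ j, (σ j ω - μ) := by
    ext ω
    rw [hE, Finset.sum_sub_distrib]
    rfl
  have hZLp : MemLp (fun ω => ∑ j, (σ j ω - μ)) 2 P :=
    memLp_finsetSum _ fun j _ => (hLp j).sub (memLp_const μ)
  rw [hZ, meanSquare, ← ofReal_integral_eq_lintegral_ofReal hZLp.integrable_sq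
    (.of_forall fun _ => sq_nonneg _), integral_sum_sub_sq measurable_σ indep law]
  rw [EReal.coe_ennreal_ofReal, Finset.card_univ, Fintype.card_fin,
    max_eq_left n.cast_nonneg]

theorem quality_belief_univ :
    quality P (𝓘).Y ((𝓘).belief Finset.univ) = (n : ℝ) := by
  have h0 : meanSquare P
      (fun ω => (𝓘).Y ω - (𝓘).belief Finset.univ ω) = 0 := by
    rw [meanSquare, lintegral_eq_zero_of_ae_eq_zero]
    · rfl
    · filter_upwards [belief_gaussianSumStructure (indep := indep) (measurable_σ := measurable_σ)
        (law := law) Finset.univ] with ω h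
      rw [h]
      simp [gaussianSumStructure]
  rw [quality, h0, meanSquare_Y_sub_integral, sub_zero]

/-- The mean squared error of the estimate `X` of `Y` is, up to the factor `(n - 1)²`, that of the
estimate `(∑ i, Y_i - X) / (n - 1)` of the common mean `n * μ` of the forecasts `Y_i`. -/
theorem lintegral_sq_Y_sub_eq (hn : 2 ≤ n) {X : (Fin n → ℝ) → ℝ} (hX : Measurable X) :
    ∫⁻ ω, ENNReal.ofReal (((𝓘).Y ω - X ((𝓘).forecasts ω)) ^ 2) ∂P =
      ENNReal.ofReal ((n - 1 : ℝ) ^ 2) *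
        ∫⁻ y, ENNReal.ofReal (((∑ i, y i - X y) / (n - 1) - n * μ) ^ 2)
          ∂gaussianSample n (n * μ) := by
  have hn1 : (n - 1 : ℝ) ≠ 0 := by
    have : (2 : ℝ) ≤ n := by exact_mod_cast hn
    linarith
  rw [← map_forecasts_gaussianSumStructure (indep := indep) (measurable_σ := measurable_σ)
    (law := law), lintegral_map (by fun_prop) (𝓘).measurable_forecasts,
    ← lintegral_const_mul' _ _ ENNReal.ofReal_ne_top]
  refine lintegral_congr_ae ?_
  filter_upwards [forecasts_gaussianSumStructure (indep := indep) (measurable_σ := measurable_σ)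
    (law := law)] with ω h
  have hY : (𝓘).Y ω = ∑ i, (𝓘).forecasts ω i - (n - 1) * (n * μ) := by
    rw [h]
    simp only [gaussianSumStructure, Finset.sum_add_distrib, Finset.sum_const, Finset.card_univ,
      Fintype.card_fin, nsmul_eq_mul]
    ring
  rw [← ENNReal.ofReal_mul (sq_nonneg _), ← mul_pow, hY]
  congr 2
  field_simp
  ring

theorem approxRatio_gaussianSumStructure (Z : Ω → ℝ) :
    (𝓘).approxRatio Z =
      (((n : ℝ) : EReal) - (∫⁻ ω, ENNReal.ofReal (((𝓘).Y ω - Z ω) ^ 2) ∂P : ℝ≥0∞)) /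
        ((n : ℝ) : EReal) := by
  change quality P (𝓘).Y Z / quality P (𝓘).Y _ = _
  rw [quality_belief_univ, quality, meanSquare_Y_sub_integral, meanSquare]

theorem randomizedApproxRatio_gaussianSumStructure (κ : Kernel (Fin n → ℝ) ℝ) [IsMarkovKernel κ] :
    (𝓘).randomizedApproxRatio κ =
      (((n : ℝ) : EReal) - (∫⁻ ω, ∫⁻ x, ENNReal.ofReal (((𝓘).Y ω - x) ^ 2)
        ∂κ ((𝓘).forecasts ω) ∂P : ℝ≥0∞)) / ((n : ℝ) : EReal) := by
  have hY : Measurable (𝓘).Y := (𝓘).measurable_Y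
  have hf := (𝓘).measurable_forecasts
  set η : Kernel Ω ℝ := κ.comap (𝓘).forecasts hf with hη
  change quality (P ⊗ₘ η) (fun p => (𝓘).Y p.1) (fun p => p.2) / quality P (𝓘).Y _ = _
  have hfst : (P ⊗ₘ η).map Prod.fst = P := Measure.fst_compProd P η
  have hE : ∫ p, (𝓘).Y p.1 ∂(P ⊗ₘ η) = ∫ ω, (𝓘).Y ω ∂P := by
    have h := integral_map (μ := P ⊗ₘ η) measurable_fst.aemeasurable hY.aestronglyMeasurable
    rw [hfst] at h
    exact h.symm
  have hvar : meanSquare (P ⊗ₘ η) (fun p => (𝓘).Y p.1 - ∫ p', (𝓘).Y p'.1 ∂(P ⊗ₘ η)) =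
      (n : ℝ) := by
    rw [← meanSquare_Y_sub_integral (indep := indep) (measurable_σ := measurable_σ) (law := law),
      hE]
    exact congrArg _ (MeasurePreserving.lintegral_comp
      (f := fun ω => ENNReal.ofReal (((𝓘).Y ω - ∫ ω', (𝓘).Y ω' ∂P) ^ 2))
      ⟨measurable_fst, hfst⟩ (by fun_prop))
  rw [quality_belief_univ, quality, hvar, meanSquare, Measure.lintegral_compProd (by fun_prop)]
  rfl

end GaussianSum

/-- A strategy that beats the ratio `2 / n - 1 / n²` has a mean squared error `M` less than
`(n - 1)² / n`, the mean squared error of the average of the forecasts. -/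
theorem mse_lt_of_lt_ratio {n : ℕ} (hn : 1 ≤ n) {M : ℝ≥0∞}
    (h : ((2 / (n : ℝ) - 1 / (n : ℝ) ^ 2 : ℝ) : EReal) <
      (((n : ℝ) : EReal) - (M : EReal)) / ((n : ℝ) : EReal)) :
    M < ENNReal.ofReal ((n - 1 : ℝ) ^ 2 * (1 / n)) := by
  have hn0 : (0 : ℝ) < n := by exact_mod_cast hn
  induction M with
  | top =>
    rw [EReal.coe_ennreal_top, EReal.sub_top,
      EReal.bot_div_of_pos_ne_top (by exact_mod_cast hn0) (EReal.coe_ne_top _)] at h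
    exact absurd h not_lt_bot
  | coe x =>
    change _ < (((n : ℝ) : EReal) - ((x : ℝ) : EReal)) / ((n : ℝ) : EReal) at h
    rw [← EReal.coe_sub, ← EReal.coe_div, EReal.coe_lt_coe_iff, lt_div_iff₀ hn0] at h
    rw [← ENNReal.ofReal_coe_nnreal]
    refine (ENNReal.ofReal_lt_ofReal_iff_of_nonneg x.coe_nonneg).2 ?_
    have e : (2 / (n : ℝ) - 1 / (n : ℝ) ^ 2) * n = n - (n - 1 : ℝ) ^ 2 * (1 / n) := by
      field_simp
      ring
    linarith

/-- Jensen's inequality for the square. No integrability is needed: if the right-hand side is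
finite, then `x` has finite variance under `ν`. -/
theorem ofReal_sub_integral_sq_le {ν : Measure ℝ} [IsProbabilityMeasure ν] (a : ℝ) :
    ENNReal.ofReal ((a - ∫ x, x ∂ν) ^ 2) ≤ ∫⁻ x, ENNReal.ofReal ((a - x) ^ 2) ∂ν := by
  by_cases htop : ∫⁻ x, ENNReal.ofReal ((a - x) ^ 2) ∂ν = ⊤
  · rw [htop]; exact le_top
  have hint : Integrable (fun x => (a - x) ^ 2) ν := by
    refine ⟨by fun_prop, ?_⟩
    rw [hasFiniteIntegral_iff_ofReal (.of_forall fun _ => sq_nonneg _)]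
    exact lt_top_iff_ne_top.2 htop
  have hLp : MemLp (fun x => a - x) 2 ν := (memLp_two_iff_integrable_sq (by fun_prop)).2 hint
  have hid : Integrable (fun x : ℝ => x) ν := by
    convert (integrable_const a).sub (hLp.integrable (by norm_num)) using 1
    ext x
    simp
  rw [← ofReal_integral_eq_lintegral_ofReal hint (.of_forall fun _ => sq_nonneg _)]
  refine ENNReal.ofReal_le_ofReal ?_
  have h := variance_nonneg (fun x => a - x) ν
  rw [variance_eq_sub hLp, integral_sub (integrable_const a) hid] at h
  simpa using h

theorem theorem3p3 (n : ℕ) (hn : 1 ≤ n)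
    -- for every `μ`, any realization of independent signals `σ μ i ∼ N(μ, 1)`
    {Ω : ℝ → Type*} [∀ μ, MeasurableSpace (Ω μ)]
    (P : ∀ μ, Measure (Ω μ)) [∀ μ, IsProbabilityMeasure (P μ)]
    (σ : ∀ μ, Fin n → Ω μ → ℝ)
    (measurable_σ : ∀ μ i, Measurable (σ μ i))
    (indep : ∀ μ, iIndepFun (σ μ) (P μ))
    (law : ∀ μ i, (P μ).map (σ μ i) = gaussianReal μ 1)
    (I : ∀ μ, InformationStructure n (Ω μ))
    (hI : ∀ μ, I μ =
      gaussianSumStructure μ (P μ) (σ μ) (measurable_σ μ) (indep μ) (law μ)) :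
    -- projective substitutes, with equality unless `i ∈ B \ A`
    (∀ μ, (I μ).ProjectiveSubstitutes) ∧
    (∀ μ, ∀ (A B : Finset (Fin n)) (i : Fin n), i ∉ B \ A →
      (I μ).predictionError B A = (I μ).predictionError (B ∪ {i}) (A ∪ {i})) ∧
    -- no deterministic prior-free aggregation strategy beats `2/n - 1/n²` for every `μ`
    (¬ ∃ X : (Fin n → ℝ) → ℝ, Measurable X ∧ ∀ μ,
      (I μ).approxRatio (fun ω => X ((I μ).forecasts ω)) >
        ((2 / (n : ℝ) - 1 / (n : ℝ) ^ 2 : ℝ) : EReal)) ∧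
    -- nor does a randomized one
    (¬ ∃ κ : Kernel (Fin n → ℝ) ℝ, IsMarkovKernel κ ∧ ∀ μ,
      (I μ).randomizedApproxRatio κ >
        ((2 / (n : ℝ) - 1 / (n : ℝ) ^ 2 : ℝ) : EReal)) := by
  obtain rfl : I = fun μ =>
      gaussianSumStructure μ (P μ) (σ μ) (measurable_σ μ) (indep μ) (law μ) := funext hI
  have hmse : ∀ X : (Fin n → ℝ) → ℝ, Measurable X → ∃ μ,
      ENNReal.ofReal ((n - 1 : ℝ) ^ 2 * (1 / n)) ≤
        ∫⁻ ω, ENNReal.ofReal (((gaussianSumStructure μ (P μ) (σ μ) (measurable_σ μ) (indep μ)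
          (law μ)).Y ω - X ((gaussianSumStructure μ (P μ) (σ μ) (measurable_σ μ) (indep μ)
          (law μ)).forecasts ω)) ^ 2) ∂P μ := by
    intro X hX
    rcases hn.eq_or_lt with rfl | hn2
    -- for `n = 1` the bound is `0`, and the division by `n - 1` below would not make sense
    · exact ⟨0, by simp⟩
    obtain ⟨m, hm⟩ := exists_le_lintegral_sq_gaussianSample (n := n) hn
      (D := fun y => (∑ i, y i - X y) / (n - 1)) (by fun_prop)
    refine ⟨m / n, ?_⟩
    rw [lintegral_sq_Y_sub_eq hn2 hX, ENNReal.ofReal_mul (sq_nonneg _),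
      mul_div_cancel₀ m (by exact_mod_cast (by omega : n ≠ 0))]
    gcongr
  refine ⟨fun μ A B i => ?_, fun μ A B i hi => ?_, ?_, ?_⟩
  · simp only [predictionError_gaussianSumStructure]
    refine Nat.cast_le.2 (Finset.card_le_card fun j hj => ?_)
    simp only [Finset.mem_sdiff, Finset.mem_union, Finset.mem_singleton] at hj ⊢
    tauto
  · simp only [predictionError_gaussianSumStructure]
    congr 2
    ext j
    simp only [Finset.mem_sdiff, Finset.mem_union, Finset.mem_singleton] at hi ⊢
    by_cases hj : j = i
    · subst hj; tauto
    · tauto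
  · rintro ⟨X, hX, hratio⟩
    obtain ⟨μ, hμ⟩ := hmse X hX
    have h := hratio μ
    rw [approxRatio_gaussianSumStructure] at h
    exact (mse_lt_of_lt_ratio hn h).not_ge hμ
  · rintro ⟨κ, hκ, hratio⟩
    -- replacing the random output by its mean does not increase the mean squared error
    obtain ⟨μ, hμ⟩ := hmse (fun y => ∫ x, x ∂κ y)
      (StronglyMeasurable.integral_kernel (f := fun x : ℝ => x) (by fun_prop)).measurable
    have h := hratio μ
    rw [randomizedApproxRatio_gaussianSumStructure] at h
    exact (mse_lt_of_lt_ratio hn h).not_ge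
      (hμ.trans (lintegral_mono fun ω => ofReal_sub_integral_sq_le _))
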